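/- Let $n\ge 1$, let $\gamma_0<\dots<\gamma_{n-1}$ be real numbers, write $[m]=\{0,\dots,m-1\}$, and let $\mathcal P$ be the law of an observed triple $(Y,D,Z)$ with $Y\in\{\gamma_0,\dots,\gamma_{n-1}\}$ almost surely, treatment $D\in\{0,1\}$, and binary instrument $Z\in\{0,1\}$ with $\mathcal P(Z=z)>0$ for $z=0,1$. Put $p_{yd,z}=\mathcal P(Y=\gamma_y,\,D=d\mid Z=z)$. A full data distribution (a joint distribution of potential outcomes $Y^{(d,z)}\in\{\gamma_0,\dots,\gamma_{n-1}\}$, potential treatments $D^{(z)}\in\{0,1\}$, the instrument $Z$, and the observed variables $Y,D$) follows the IV model if (a) (exclusion) $Y^{(d,z)}=Y^{(d,z')}$ almost surely for all $d,z,z'$, the common variable being denoted $Y^{(d)}$; (b) (random assignment) $Z$ is independent of $(Y^{(0)},Y^{(1)},D^{(0)},D^{(1)})$; and (c) (consistency) $Y=(1-D)Y^{(0)}+DY^{(1)}$ and $D=\sum_{z}\mathbf 1(Z=z)D^{(z)}$ almost surely. Consider the linear inequalities $$ \begin{aligned} &\sum_{k\in[n]}-p_{k0,1}+\sum_{k\in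 T}(p_{k1,0}-p_{k1,1})\le 0 &&\text{for all } \varnothing\ne T\subseteq[n-1],\\ &\sum_{k\in[n]}-p_{k1,0}+\sum_{k\in T}(p_{k0,1}-p_{k0,0})\le 0 &&\text{for all } \varnothing\ne T\subsetneq[n],\\ &\sum_{k\in[n]}-p_{k0,0}+\sum_{k\in T}(p_{k1,1}-p_{k1,0})\le 0 &&\text{for all } \varnothing\ne T\subseteq[n-1]. \end{aligned} $$ Theorem. (i) For every observed law $\mathcal P$ as above, there is a full data distribution that follows the IV model and induces $\mathcal P$ as the law of $(Y,D,Z)$ if and only if all of these inequalities hold. (ii) None of them is redundant: for each of the inequalities there is an observed law $\mathcal P$ as above that violates it and satisfies all the others. (iii) The inequalities are pairwise distinct as linear inequalities in the variables $(p_{yd,z})$, and their number is exactly $2^{n+1}-4$. -/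

import Mathlib

open MeasureTheory ProbabilityTheory

universe u

/-- The discrete instrumental variable model with outcome support `{γ 0, …, γ (n-1)}`, dichotomous
treatment and instrument with values in `{0, …, ℓ-1}`, on a probability space `(Ω, μ)`:
`Ypot d z` is the potential outcome `Y^(d,z)`, `Dpot z` is the potential treatment `D^(z)`, and
`(Y, D, Z)` are the observed outcome, treatment and instrument. By exclusion, `Y^(d)` is any of the
almost surely equal variables `Y^(d,z)`; the conditions on `Y^(0)`, `Y^(1)` are stated for each of
these versions. -/
structure IsIVModel {n ℓ : ℕ} (γ : Fin n → ℝ) {Ω : Type u} [MeasurableSpace Ω] (μ : Measure Ω)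
    (Ypot : Fin 2 → Fin ℓ → Ω → ℝ) (Dpot : Fin ℓ → Ω → Fin 2)
    (Y : Ω → ℝ) (D : Ω → Fin 2) (Z : Ω → Fin ℓ) : Prop where
  isProbabilityMeasure : IsProbabilityMeasure μ
  measurable_Ypot : ∀ d z, Measurable (Ypot d z)
  measurable_Dpot : ∀ z, Measurable (Dpot z)
  measurable_Y : Measurable Y
  measurable_D : Measurable D
  measurable_Z : Measurable Z
  /-- The outcome takes values in the finite set of the `γ i`. -/
  support : ∀ d z, ∀ᵐ ω ∂μ, Ypot d z ω ∈ Set.range γ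
  /-- Individual-level exclusion. -/
  exclusion : ∀ d z z', Ypot d z =ᵐ[μ] Ypot d z'
  /-- Random assignment: `Z` is independent of `(Y^(0), Y^(1), D^(0), …, D^(ℓ-1))`. -/
  randomAssignment : ∀ z₀,
    IndepFun Z (fun ω => (Ypot 0 z₀ ω, Ypot 1 z₀ ω, fun z => Dpot z ω)) μ
  /-- Consistency of the outcome: `Y = (1 - D) Y^(0) + D Y^(1)`. -/
  consistency_Y : ∀ z₀, ∀ᵐ ω ∂μ,
    Y ω = (1 - ((D ω : ℕ) : ℝ)) * Ypot 0 z₀ ω + ((D ω : ℕ) : ℝ) * Ypot 1 z₀ ω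
  /-- Consistency of the treatment: `D = ∑ z, 1(Z = z) D^(z)`. -/
  consistency_D : ∀ᵐ ω ∂μ,
    ((D ω : ℕ) : ℝ) = ∑ z, if Z ω = z then ((Dpot z ω : ℕ) : ℝ) else 0

/-- An observed law, i.e. a law of `(Y, D, Z)`: the outcome has support in `{γ i}` and every value
of the instrument has positive probability. -/
structure IsObservedLaw {n ℓ : ℕ} (γ : Fin n → ℝ) (P : Measure (ℝ × Fin 2 × Fin ℓ)) : Prop where
  isProbabilityMeasure : IsProbabilityMeasure P
  support : ∀ᵐ o ∂P, o.1 ∈ Set.range γ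
  instrument_pos : ∀ z, 0 < P {o | o.2.2 = z}

/-- The IV model is compatible with the observed law `P`: some full data distribution following
the IV model induces `P` as the law of `(Y, D, Z)`. -/
def IVCompatible {n ℓ : ℕ} (γ : Fin n → ℝ) (P : Measure (ℝ × Fin 2 × Fin ℓ)) : Prop :=
  ∃ (Ω : Type u) (_ : MeasurableSpace Ω) (μ : Measure Ω)
    (Ypot : Fin 2 → Fin ℓ → Ω → ℝ) (Dpot : Fin ℓ → Ω → Fin 2)
    (Y : Ω → ℝ) (D : Ω → Fin 2) (Z : Ω → Fin ℓ),
    IsIVModel γ μ Ypot Dpot Y D Z ∧ μ.map (fun ω => (Y ω, D ω, Z ω)) = P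

/-- `p_{yd,z} = P(Y = γ_y, D = d | Z = z)`. -/
noncomputable def condProb {n ℓ : ℕ} (γ : Fin n → ℝ) (P : Measure (ℝ × Fin 2 × Fin ℓ))
    (y : Fin n) (d : Fin 2) (z : Fin ℓ) : ℝ :=
  (ProbabilityTheory.cond P {o | o.2.2 = z}).real {o | o.1 = γ y ∧ o.2.1 = d}

/-- `∑_k -p_{k0,1} + ∑_{k ∈ T} (p_{k1,0} - p_{k1,1})`. -/
def ivForm₁ {n : ℕ} (T : Finset (Fin n)) (p : Fin n → Fin 2 → Fin 2 → ℝ) : ℝ :=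
  (∑ k, -p k 0 1) + ∑ k ∈ T, (p k 1 0 - p k 1 1)

/-- `∑_k -p_{k1,0} + ∑_{k ∈ T} (p_{k0,1} - p_{k0,0})`. -/
def ivForm₂ {n : ℕ} (T : Finset (Fin n)) (p : Fin n → Fin 2 → Fin 2 → ℝ) : ℝ :=
  (∑ k, -p k 1 0) + ∑ k ∈ T, (p k 0 1 - p k 0 0)

/-- `∑_k -p_{k0,0} + ∑_{k ∈ T} (p_{k1,1} - p_{k1,0})`. -/
def ivForm₃ {n : ℕ} (T : Finset (Fin n)) (p : Fin n → Fin 2 → Fin 2 → ℝ) : ℝ :=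
  (∑ k, -p k 0 0) + ∑ k ∈ T, (p k 1 1 - p k 1 0)

/-- The set of linear forms `L` in `(p_{yd,z})` whose inequalities `L p ≤ 0` are the IV
inequalities: the first and third families are indexed by the nonempty `T ⊆ {0, …, n-2}`, the
second by the nonempty proper subsets `T` of `{0, …, n-1}`. -/
def ivForms (n : ℕ) : Set ((Fin n → Fin 2 → Fin 2 → ℝ) → ℝ) :=
  {L | ∃ T : Finset (Fin n), T.Nonempty ∧ (∀ k ∈ T, (k : ℕ) + 1 < n) ∧ L = ivForm₁ T} ∪
  {L | ∃ T : Finset (Fin n), T.Nonempty ∧ T ⊂ Finset.univ ∧ L = ivForm₂ T} ∪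
  {L | ∃ T : Finset (Fin n), T.Nonempty ∧ (∀ k ∈ T, (k : ℕ) + 1 < n) ∧ L = ivForm₃ T}

/-!
On conditional probability tables each of the listed linear forms equals `∑ k, p k d (z k) - 1` for
one treatment `d` and one nonconstant choice `z` of values of the instrument (a constant `z` gives a
trivial inequality). These are Pearl's instrumental inequalities, and they are necessary because the
events `{Y^(d) = γ k, D^(z k) = d}` are disjoint.

They are sufficient: for the `z` that maximises `p k d (z k)` at each `k` the inequality says that
`∑ k, p k d 0 + ∑ k, p k d 1 - 1 ≤ ∑ k, min (p k d 0) (p k d 1)`. The left side is the mass that is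
forced to take `d` under both values of the instrument, so it can be split off from the common part
of the columns `(d, 0)` and `(d, 1)`: these are never-takers if `d = 0` and always-takers if
`d = 1`. What remains of the columns `(0, z)` and `(1, 1 - z)` has equal mass, and a coupling of the
two gives the compliers or the defiers. The instrument is then drawn independently.

None is redundant: spreading mass `1 / (n - 1)` over each of the `n` cells `(k, z k)` of the arm `d`
violates the inequality of `(d, z)`, while any other choice in this arm misses one of the cells.
This table also tells the linear forms apart, so that counting them amounts to counting pairs
`(d, z)` with `z` nonconstant.
-/

theorem exists_apply_ne {ι ζ : Type*} {f : ι → ζ} (hf : ∃ i j, f i ≠ f j) (z : ζ) :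
    ∃ k, f k ≠ z := by
  contrapose! hf
  exact fun i j => (hf i).trans (hf j).symm

section FiniteSums

variable {ι κ : Type*} [Fintype ι] [Fintype κ]

theorem exists_nonneg_matrix_of_marginals {x : ι → ℝ} {y : κ → ℝ} (hx : ∀ i, 0 ≤ x i)
    (hy : ∀ j, 0 ≤ y j) (h : ∑ i, x i = ∑ j, y j) :
    ∃ r : ι → κ → ℝ, (∀ i j, 0 ≤ r i j) ∧ (∀ i, ∑ j, r i j = x i) ∧ ∀ j, ∑ i, r i j = y j := by
  refine ⟨fun i j => x i * y j / ∑ i, x i, fun i j => ?_, fun i => ?_, fun j => ?_⟩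
  · exact div_nonneg (mul_nonneg (hx i) (hy j)) (Finset.sum_nonneg fun i _ => hx i)
  · rw [← Finset.sum_div, ← Finset.mul_sum, ← h]
    exact mul_div_cancel_of_imp fun h0 =>
      (Finset.sum_eq_zero_iff_of_nonneg fun i _ => hx i).1 h0 i (Finset.mem_univ i)
  · rw [← Finset.sum_div, ← Finset.sum_mul, mul_comm, h]
    exact mul_div_cancel_of_imp fun h0 =>
      (Finset.sum_eq_zero_iff_of_nonneg fun j _ => hy j).1 h0 j (Finset.mem_univ j)

theorem exists_le_sum_eq {m : ι → ℝ} (hm : ∀ i, 0 ≤ m i) {t : ℝ} (ht : 0 ≤ t)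
    (htm : t ≤ ∑ i, m i) : ∃ u : ι → ℝ, (∀ i, 0 ≤ u i) ∧ (∀ i, u i ≤ m i) ∧ ∑ i, u i = t := by
  have hs : 0 ≤ ∑ i, m i := Finset.sum_nonneg fun i _ => hm i
  refine ⟨fun i => t / (∑ i, m i) * m i, fun i => mul_nonneg (div_nonneg ht hs) (hm i),
    fun i => mul_le_of_le_one_left (hm i) (div_le_one_of_le₀ htm hs), ?_⟩
  rw [← Finset.mul_sum]
  exact div_mul_cancel_of_imp fun h0 => le_antisymm (h0 ▸ htm) ht

theorem sum_fin_two_arrow {α M : Type*} [Fintype α] [AddCommMonoid M] (f : (Fin 2 → α) → M) :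
    ∑ x, f x = ∑ i, ∑ j, f ![i, j] := by
  rw [← Fintype.sum_prod_type', ← (finTwoArrowEquiv α).symm.sum_comp]
  rfl

theorem exists_sum_apply_eq_sum_max (a : ι → Fin 2 → ℝ) :
    ∃ z : ι → Fin 2, ∑ k, a k (z k) = ∑ k, max (a k 0) (a k 1) := by
  refine ⟨fun k => if a k 1 ≤ a k 0 then 0 else 1, Finset.sum_congr rfl fun k _ => ?_⟩
  dsimp only
  split_ifs with h
  · rw [max_eq_left h]
  · rw [max_eq_right (not_le.1 h).le]

theorem card_filter_le_card_sub_one {P : ι → Prop} [DecidablePred P] (h : ∃ k, ¬P k) :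
    (Finset.card {k | P k} : ℝ) ≤ Fintype.card ι - 1 := by
  obtain ⟨k, hk⟩ := h
  rw [le_sub_iff_add_le]
  exact_mod_cast Finset.card_lt_univ_of_notMem (x := k) (by simpa using hk)

theorem card_fiber_le_card_sub_one {ζ : Type*} [DecidableEq ζ] {f : ι → ζ}
    (hf : ∃ i j, f i ≠ f j) (z : ζ) : (Finset.card {k | f k = z} : ℝ) ≤ Fintype.card ι - 1 :=
  card_filter_le_card_sub_one (exists_apply_ne hf z)

theorem one_lt_card_of_exists_apply_ne {ζ : Type*} {f : ι → ζ} (hf : ∃ i j, f i ≠ f j) :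
    (1 : ℝ) < Fintype.card ι := by
  obtain ⟨i, j, hij⟩ := hf
  exact_mod_cast Fintype.one_lt_card_iff.2 ⟨i, j, ne_of_apply_ne f hij⟩

end FiniteSums

/-- A table of conditional probabilities `p k d z` of the outcome `k` and the treatment `d` given
the value `z` of the instrument. -/
structure IsCondTable {ι ζ : Type*} [Fintype ι] (p : ι → Fin 2 → ζ → ℝ) : Prop where
  nonneg : ∀ k d z, 0 ≤ p k d z
  sum_eq_one : ∀ z, ∑ k, ∑ d, p k d z = 1

namespace IsCondTable

variable {ι ζ : Type*} [Fintype ι] {p : ι → Fin 2 → ζ → ℝ}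

theorem sum_add_sum_rev (hp : IsCondTable p) (d : Fin 2) (z : ζ) :
    ∑ k, p k d z + ∑ k, p k d.rev z = 1 := by
  rw [← hp.sum_eq_one z, ← Finset.sum_add_distrib]
  refine Finset.sum_congr rfl fun k _ => ?_
  fin_cases d
  · simp
  · simp [add_comm]

theorem sum_le_one (hp : IsCondTable p) (d : Fin 2) (z : ζ) : ∑ k, p k d z ≤ 1 := by
  have := Finset.sum_nonneg fun k (_ : k ∈ Finset.univ) => hp.nonneg k d.rev z
  linarith [hp.sum_add_sum_rev d z]

end IsCondTable

section ExtremalTable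

variable {ι ζ : Type*} [Fintype ι] [DecidableEq ζ]

/-- The conditional probability table which, for a nonconstant `z₀`, violates the inequality
`∑ k, p k d₀ (z₀ k) ≤ 1` but no other one of this kind: in the arm `d₀` it puts mass `1 / (m - 1)`
on each of the `m` cells `(k, z₀ k)`, and in the other arm it spreads the remaining mass evenly. -/
noncomputable def extremalTable (d₀ : Fin 2) (z₀ : ι → ζ) : ι → Fin 2 → ζ → ℝ := fun k d z =>
  if d = d₀ then if z₀ k = z then 1 / ((Fintype.card ι : ℝ) - 1) else 0
  else (1 - Finset.card {k | z₀ k = z} / ((Fintype.card ι : ℝ) - 1)) / Fintype.card ι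

variable {z₀ : ι → ζ}

theorem sum_extremalTable_self (d₀ : Fin 2) (z₀ z : ι → ζ) :
    ∑ k, extremalTable d₀ z₀ k d₀ (z k) =
      Finset.card {k | z₀ k = z k} / ((Fintype.card ι : ℝ) - 1) := by
  simp [extremalTable, Finset.sum_ite, div_eq_mul_inv]

theorem isCondTable_extremalTable (d₀ : Fin 2) (hz₀ : ∃ i j, z₀ i ≠ z₀ j) :
    IsCondTable (extremalTable d₀ z₀) := by
  have hcard := one_lt_card_of_exists_apply_ne hz₀
  have hfiber := card_fiber_le_card_sub_one hz₀
  constructor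
  · intro k d z
    have : (Finset.card {k | z₀ k = z} : ℝ) / (Fintype.card ι - 1) ≤ 1 :=
      div_le_one_of_le₀ (hfiber z) (by linarith)
    unfold extremalTable
    split_ifs
    · exact one_div_nonneg.2 (by linarith)
    · exact le_rfl
    · exact div_nonneg (by linarith) (by linarith)
  · intro z
    have hother : ∑ k, extremalTable d₀ z₀ k d₀.rev z =
        1 - Finset.card {k | z₀ k = z} / ((Fintype.card ι : ℝ) - 1) := by
      have hne : d₀.rev ≠ d₀ := by decide +revert
      simp only [extremalTable, if_neg hne, Finset.sum_const, Finset.card_univ, nsmul_eq_mul]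
      exact mul_div_cancel₀ _ (by linarith)
    have hsum (k : ι) : ∑ d, extremalTable d₀ z₀ k d z =
        extremalTable d₀ z₀ k d₀ z + extremalTable d₀ z₀ k d₀.rev z := by
      fin_cases d₀
      · simp
      · simp [add_comm]
    simp only [hsum, Finset.sum_add_distrib, hother, sum_extremalTable_self d₀ z₀ fun _ => z]
    ring

theorem one_lt_sum_extremalTable (d₀ : Fin 2) (hz₀ : ∃ i j, z₀ i ≠ z₀ j) :
    1 < ∑ k, extremalTable d₀ z₀ k d₀ (z₀ k) := by
  have := one_lt_card_of_exists_apply_ne hz₀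
  rw [sum_extremalTable_self, one_lt_div (by linarith)]
  simp

theorem sum_extremalTable_le_one (d₀ : Fin 2) (hz₀ : ∃ i j, z₀ i ≠ z₀ j) {d : Fin 2} {z : ι → ζ}
    (h : (d, z) ≠ (d₀, z₀)) : ∑ k, extremalTable d₀ z₀ k d (z k) ≤ 1 := by
  have hcard := one_lt_card_of_exists_apply_ne hz₀
  obtain rfl | hd := eq_or_ne d d₀
  · have hz : ∃ k, z₀ k ≠ z k := Function.ne_iff.1 fun h' => h (by rw [h'])
    rw [sum_extremalTable_self]
    exact div_le_one_of_le₀ (card_filter_le_card_sub_one hz) (by linarith)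
  · calc ∑ k, extremalTable d₀ z₀ k d (z k)
        ≤ ∑ _k : ι, 1 / (Fintype.card ι : ℝ) := by
          refine Finset.sum_le_sum fun k _ => ?_
          rw [extremalTable, if_neg hd]
          gcongr
          exact sub_le_self _ (div_nonneg (Nat.cast_nonneg _) (by linarith))
      _ = 1 := by
          rw [Finset.sum_const, Finset.card_univ, nsmul_eq_mul]
          exact mul_one_div_cancel (by linarith)

end ExtremalTable

/-- The outcome and the treatment observed under the value `z` of the instrument for an individual
of response type `x`, which consists of the potential outcomes `x.1 d` under the treatments `d` and
the potential treatments `x.2 z` under the values `z` of the instrument. -/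
def observedResponse {ι ζ : Type*} (x : (Fin 2 → ι) × (ζ → Fin 2)) (z : ζ) : ι × Fin 2 :=
  (x.1 (x.2 z), x.2 z)

section PrincipalStrata

variable {ι : Type*} [Fintype ι] {p : ι → Fin 2 → Fin 2 → ℝ}

theorem sum_add_sum_sub_one_le_sum_min {a : ι → Fin 2 → ℝ}
    (h : ∀ z : ι → Fin 2, ∑ k, a k (z k) ≤ 1) :
    ∑ k, a k 0 + ∑ k, a k 1 - 1 ≤ ∑ k, min (a k 0) (a k 1) := by
  obtain ⟨z, hz⟩ := exists_sum_apply_eq_sum_max a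
  have hmax_min : ∑ k, max (a k 0) (a k 1) + ∑ k, min (a k 0) (a k 1) =
      ∑ k, a k 0 + ∑ k, a k 1 := by
    simp only [← Finset.sum_add_distrib, max_add_min]
  linarith [h z]

/-- The principal strata `u` of never-takers and `v` of always-takers: the conclusion says that what
they leave of the four columns of `p` can be shared between compliers and defiers. -/
theorem IsCondTable.exists_neverTakers_alwaysTakers (hp : IsCondTable p)
    (h : ∀ d (z : ι → Fin 2), ∑ k, p k d (z k) ≤ 1) :
    ∃ u v : ι → ℝ, (∀ k, 0 ≤ u k) ∧ (∀ k, 0 ≤ v k) ∧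
      (∀ k z, u k ≤ p k 0 z) ∧ (∀ k z, v k ≤ p k 1 z) ∧
      ∀ z, ∑ k, (p k 0 z - u k) = ∑ k, (p k 1 z.rev - v k) := by
  have hcol (z : Fin 2) : ∑ k, p k 0 z + ∑ k, p k 1 z = 1 := hp.sum_add_sum_rev 0 z
  have hmin (d : Fin 2) (k : ι) : 0 ≤ min (p k d 0) (p k d 1) :=
    le_min (hp.nonneg _ _ _) (hp.nonneg _ _ _)
  have hmin_sum (d : Fin 2) : 0 ≤ ∑ k, min (p k d 0) (p k d 1) :=
    Finset.sum_nonneg fun k _ => hmin d k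
  -- `c` is the excess of never-takers over always-takers forced by the column sums.
  set c := ∑ k, p k 0 0 + ∑ k, p k 0 1 - 1
  obtain ⟨u, hu0, hu, hu_sum⟩ := exists_le_sum_eq (hmin 0) (posPart_nonneg c)
    (sup_le (sum_add_sum_sub_one_le_sum_min (h 0)) (hmin_sum 0))
  obtain ⟨v, hv0, hv, hv_sum⟩ := exists_le_sum_eq (hmin 1) (negPart_nonneg c)
    (sup_le (by linarith [sum_add_sum_sub_one_le_sum_min (h 1), hcol 0, hcol 1])
      (hmin_sum 1))
  have huv : ∑ k, u k - ∑ k, v k = c := by rw [hu_sum, hv_sum, posPart_sub_negPart]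
  refine ⟨u, v, hu0, hv0, fun k => Fin.forall_fin_two.2 (le_min_iff.1 (hu k)),
    fun k => Fin.forall_fin_two.2 (le_min_iff.1 (hv k)), fun z => ?_⟩
  rw [Finset.sum_sub_distrib, Finset.sum_sub_distrib]
  fin_cases z
  · change ∑ k, p k 0 0 - _ = ∑ k, p k 1 1 - _
    linarith [hcol 1]
  · change ∑ k, p k 0 1 - _ = ∑ k, p k 1 0 - _
    linarith [hcol 0]

theorem IsCondTable.exists_responseType_weights [DecidableEq ι] (hp : IsCondTable p)
    (h : ∀ d (z : ι → Fin 2), ∑ k, p k d (z k) ≤ 1) :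
    ∃ w : (Fin 2 → ι) × (Fin 2 → Fin 2) → ℝ, (∀ x, 0 ≤ w x) ∧
      ∀ k d z, ∑ x with observedResponse x z = (k, d), w x = p k d z := by
  obtain ⟨u, v, hu0, hv0, hu, hv, hsum⟩ := hp.exists_neverTakers_alwaysTakers h
  have exists_joint (z : Fin 2) := exists_nonneg_matrix_of_marginals
    (fun k => sub_nonneg.2 (hu k z)) (fun k => sub_nonneg.2 (hv k z.rev)) (hsum z)
  obtain ⟨r, hr0, hr_row, hr_col⟩ := exists_joint 0
  obtain ⟨s, hs0, hs_row, hs_col⟩ := exists_joint 1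
  -- Strata are indexed by the potential treatments: never-takers `(0, 0)`, compliers `(0, 1)`,
  -- defiers `(1, 0)`, always-takers `(1, 1)`. Never- and always-takers may have equal outcomes.
  let q : Fin 2 → Fin 2 → ι → ι → ℝ :=
    ![![fun i j => if i = j then u i else 0, r], ![s, fun i j => if i = j then v j else 0]]
  refine ⟨fun x => q (x.2 0) (x.2 1) (x.1 0) (x.1 1), fun x => ?_, fun k d z => ?_⟩
  · have hq0 (s t : Fin 2) (i j : ι) : 0 ≤ q s t i j := by
      fin_cases s <;> fin_cases t <;> dsimp [q] <;> (try split_ifs) <;>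
        first | exact le_rfl | apply_assumption
    exact hq0 _ _ _ _
  · fin_cases d <;> fin_cases z <;>
      simp [Finset.sum_filter, observedResponse, q, Fintype.sum_prod_type, sum_fin_two_arrow,
        Finset.sum_add_distrib, hr_row, hr_col, hs_row, hs_col]

end PrincipalStrata

section FacetForms

theorem eq_rev_of_ne {a b : Fin 2} (h : a ≠ b) : a = b.rev := by
  decide +revert

theorem rev_ne (b : Fin 2) : b.rev ≠ b := by
  decide +revert

/-- The common shape of the three families of linear forms: `ivForm₁`, `ivForm₂` and `ivForm₃` are
`ivForm 1 1`, `ivForm 0 0` and `ivForm 1 0`. -/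
def ivForm {n : ℕ} (d b : Fin 2) (T : Finset (Fin n)) (p : Fin n → Fin 2 → Fin 2 → ℝ) : ℝ :=
  (∑ k, -p k d.rev b) + ∑ k ∈ T, (p k d b.rev - p k d b)

variable {m : ℕ}

/-- The value `b` of the instrument for which the linear form `ivForm d b {k | z k ≠ b}` is one of
the `ivForms`. Both `ivForm d 0 {k | z k ≠ 0}` and `ivForm d 1 {k | z k ≠ 1}` equal
`∑ k, p k d (z k) - 1` on conditional probability tables `p`, but only one of them is listed. -/
def baseValue (d : Fin 2) (z : Fin (m + 1) → Fin 2) : Fin 2 :=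
  if d = 0 then 0 else z (Fin.last m)

/-- The linear form among the `ivForms` which expresses the inequality `∑ k, p k d (z k) ≤ 1`. -/
def pearlForm (d : Fin 2) (z : Fin (m + 1) → Fin 2) : (Fin (m + 1) → Fin 2 → Fin 2 → ℝ) → ℝ :=
  ivForm d (baseValue d z) {k | z k ≠ baseValue d z}

theorem IsCondTable.ivForm_apply {n : ℕ} {p : Fin n → Fin 2 → Fin 2 → ℝ} (hp : IsCondTable p)
    (d b : Fin 2) (z : Fin n → Fin 2) :
    ivForm d b {k | z k ≠ b} p = ∑ k, p k d (z k) - 1 := by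
  have hswitch (k : Fin n) : (if z k ≠ b then p k d b.rev - p k d b else 0) =
      p k d (z k) - p k d b := by
    obtain h | h := eq_or_ne (z k) b
    · simp [h]
    · rw [if_pos h, eq_rev_of_ne h]
  rw [ivForm, Finset.sum_filter, Finset.sum_congr rfl fun k _ => hswitch k,
    Finset.sum_sub_distrib, Finset.sum_neg_distrib]
  linarith [hp.sum_add_sum_rev d b]

theorem IsCondTable.pearlForm_apply {p : Fin (m + 1) → Fin 2 → Fin 2 → ℝ} (hp : IsCondTable p)
    (d : Fin 2) (z : Fin (m + 1) → Fin 2) : pearlForm d z p = ∑ k, p k d (z k) - 1 :=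
  hp.ivForm_apply d _ z

theorem forall_mem_add_one_lt_iff {T : Finset (Fin (m + 1))} :
    (∀ k ∈ T, (k : ℕ) + 1 < m + 1) ↔ Fin.last m ∉ T := by
  refine ⟨fun h hlast => (h _ hlast).ne rfl, fun h k hk => ?_⟩
  exact Nat.succ_lt_succ (Fin.lt_last_iff_ne_last.2 fun h' => h (h' ▸ hk))

theorem exists_pearlForm_eq_ivForm {d b : Fin 2} {T : Finset (Fin (m + 1))} (hT : T.Nonempty)
    (hT' : T ≠ Finset.univ) (hb : if d = 0 then b = 0 else Fin.last m ∉ T) :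
    ∃ z : Fin (m + 1) → Fin 2, (∃ i j, z i ≠ z j) ∧ pearlForm d z = ivForm d b T := by
  obtain ⟨i, hi⟩ := hT
  obtain ⟨j, hj⟩ : ∃ j, j ∉ T := by simpa [Finset.eq_univ_iff_forall] using hT'
  refine ⟨fun k => if k ∈ T then b.rev else b, ⟨i, j, by simpa [hi, hj] using rev_ne b⟩, ?_⟩
  have hbase : baseValue d (fun k => if k ∈ T then b.rev else b) = b := by
    unfold baseValue
    split_ifs at hb ⊢ with hd <;> simp_all
  have hset : ({k | (if k ∈ T then b.rev else b) ≠ b} : Finset (Fin (m + 1))) = T := by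
    ext k
    by_cases hk : k ∈ T <;> simp [hk, rev_ne]
  rw [pearlForm, hbase, hset]

theorem pearlForm_mem_ivForms (d : Fin 2) {z : Fin (m + 1) → Fin 2} (hz : ∃ i j, z i ≠ z j) :
    pearlForm d z ∈ ivForms (m + 1) := by
  have nonempty (b : Fin 2) : ({k | z k ≠ b} : Finset (Fin (m + 1))).Nonempty := by
    simpa [Finset.filter_nonempty_iff] using exists_apply_ne hz b
  have last_notMem : Fin.last m ∉ ({k | z k ≠ z (Fin.last m)} : Finset (Fin (m + 1))) := by simp
  rw [← forall_mem_add_one_lt_iff] at last_notMem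
  obtain rfl | rfl : d = 0 ∨ d = 1 := by omega
  · obtain ⟨k, hk⟩ := exists_apply_ne hz 1
    refine Or.inl (Or.inr ⟨_, nonempty 0, Finset.ssubset_univ_iff.2 fun h => ?_, rfl⟩)
    have : z k ≠ 0 := by simpa using h.ge (Finset.mem_univ k)
    omega
  · have hform : pearlForm 1 z = ivForm 1 (z (Fin.last m)) {k | z k ≠ z (Fin.last m)} := rfl
    rw [hform]
    obtain hlast | hlast : z (Fin.last m) = 1 ∨ z (Fin.last m) = 0 := by omega
    · rw [hlast] at last_notMem ⊢
      exact Or.inl (Or.inl ⟨_, nonempty 1, last_notMem, rfl⟩)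
    · rw [hlast] at last_notMem ⊢
      exact Or.inr ⟨_, nonempty 0, last_notMem, rfl⟩

theorem ivForms_eq_image_pearlForm : ivForms (m + 1) =
    (fun x : Fin 2 × (Fin (m + 1) → Fin 2) => pearlForm x.1 x.2) ''
      {x | ∃ i j, x.2 i ≠ x.2 j} := by
  refine Set.Subset.antisymm ?_ (Set.image_subset_iff.2 fun x hx => pearlForm_mem_ivForms x.1 hx)
  have mem_image {d b : Fin 2} {T : Finset (Fin (m + 1))} (hT : T.Nonempty)
      (hT' : T ≠ Finset.univ) (hb : if d = 0 then b = 0 else Fin.last m ∉ T) :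
      ivForm d b T ∈ (fun x : Fin 2 × (Fin (m + 1) → Fin 2) => pearlForm x.1 x.2) ''
        {x | ∃ i j, x.2 i ≠ x.2 j} :=
    let ⟨z, hz, h⟩ := exists_pearlForm_eq_ivForm hT hT' hb
    ⟨(d, z), hz, h⟩
  have ne_univ {T : Finset (Fin (m + 1))} (h : Fin.last m ∉ T) : T ≠ Finset.univ :=
    fun h' => h (h' ▸ Finset.mem_univ _)
  rintro _ ((⟨T, hT, hlast, rfl⟩ | ⟨T, hT, hT', rfl⟩) | ⟨T, hT, hlast, rfl⟩)
  · rw [forall_mem_add_one_lt_iff] at hlast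
    exact mem_image (d := 1) (b := 1) hT (ne_univ hlast) hlast
  · exact mem_image (d := 0) (b := 0) hT hT'.ne rfl
  · rw [forall_mem_add_one_lt_iff] at hlast
    exact mem_image (d := 1) (b := 0) hT (ne_univ hlast) hlast

theorem forall_mem_ivForms_iff {p : Fin (m + 1) → Fin 2 → Fin 2 → ℝ} (hp : IsCondTable p) :
    (∀ L ∈ ivForms (m + 1), L p ≤ 0) ↔
      ∀ d (z : Fin (m + 1) → Fin 2), ∑ k, p k d (z k) ≤ 1 := by
  simp only [ivForms_eq_image_pearlForm, Set.forall_mem_image, hp.pearlForm_apply, sub_nonpos,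
    Prod.forall]
  refine ⟨fun h d z => ?_, fun h d z _ => h d z⟩
  by_cases hz : ∃ i j, z i ≠ z j
  · exact h d z hz
  · push Not at hz
    simpa only [hz _ 0] using hp.sum_le_one d (z 0)

end FacetForms

section FiniteMeasures

variable {α β : Type*} [MeasurableSpace β] [MeasurableSingletonClass β]

theorem exists_isProbabilityMeasure_real_singleton [Fintype α] {f : α → β}
    (hf : Function.Injective f) {w : α → ℝ} (hw : ∀ x, 0 ≤ w x) (hw_sum : ∑ x, w x = 1) :
    ∃ P : Measure β, IsProbabilityMeasure P ∧ (∀ᵐ y ∂P, y ∈ Set.range f) ∧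
      ∀ x, P.real {f x} = w x := by
  have hw_sum' : ∑ x, ENNReal.ofReal (w x) = 1 := by
    rw [← ENNReal.ofReal_sum_of_nonneg fun x _ => hw x, hw_sum, ENNReal.ofReal_one]
  let : MeasurableSpace α := ⊤
  have hf_meas : Measurable f := measurable_from_top
  refine ⟨(PMF.ofFintype _ hw_sum').toMeasure.map f,
    Measure.isProbabilityMeasure_map hf_meas.aemeasurable,
    ae_map_mem_range f (Set.finite_range f).measurableSet _, fun x => ?_⟩
  rw [map_measureReal_apply hf_meas (measurableSet_singleton _), ← Set.image_singleton,
    hf.preimage_image, measureReal_def,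
    PMF.toMeasure_apply_singleton _ _ (measurableSet_singleton x), PMF.ofFintype_apply,
    ENNReal.toReal_ofReal (hw x)]

variable {P Q : Measure β} [IsFiniteMeasure P] [IsFiniteMeasure Q] {f : α → β}

theorem measureReal_eq_sum_of_ae_mem_range [Fintype α] (hf : Function.Injective f)
    (hP : ∀ᵐ y ∂P, y ∈ Set.range f) (s : Set β) [DecidablePred (· ∈ s)] :
    P.real s = ∑ x with f x ∈ s, P.real {f x} := by
  have hs : P.real s = P.real (({x | f x ∈ s} : Finset α).map ⟨f, hf⟩) := by
    refine measureReal_congr (Filter.eventuallyEq_set.2 ?_)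
    filter_upwards [hP] with y ⟨x, hx⟩
    simp [← hx, hf.eq_iff]
  rw [hs, ← sum_measureReal_singleton, Finset.sum_map]
  rfl

theorem measure_ext_of_ae_mem_range [Finite α] (hf : Function.Injective f)
    (hP : ∀ᵐ y ∂P, y ∈ Set.range f) (hQ : ∀ᵐ y ∂Q, y ∈ Set.range f)
    (h : ∀ x, P.real {f x} = Q.real {f x}) : P = Q := by
  classical
  have := Fintype.ofFinite α
  ext s -
  rw [← measureReal_eq_measureReal_iff, measureReal_eq_sum_of_ae_mem_range hf hP,
    measureReal_eq_sum_of_ae_mem_range hf hQ]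
  exact Finset.sum_congr rfl fun x _ => h x

end FiniteMeasures

section ObservedLaws

variable {n ℓ : ℕ} {γ : Fin n → ℝ} {P Q : Measure (ℝ × Fin 2 × Fin ℓ)}

theorem measurableSet_instrument (z : Fin ℓ) :
    MeasurableSet {o : ℝ × Fin 2 × Fin ℓ | o.2.2 = z} :=
  measurable_snd.snd (measurableSet_singleton z)

theorem condProb_eq_div (γ : Fin n → ℝ) (P : Measure (ℝ × Fin 2 × Fin ℓ)) (k : Fin n) (d : Fin 2)
    (z : Fin ℓ) : condProb γ P k d z = P.real {(γ k, d, z)} / P.real {o | o.2.2 = z} := by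
  have hcell : {o : ℝ × Fin 2 × Fin ℓ | o.2.2 = z} ∩ {o | o.1 = γ k ∧ o.2.1 = d} =
      {(γ k, d, z)} := by
    ext ⟨y, d', z'⟩
    simp only [Set.mem_inter_iff, Set.mem_ofPred_eq, Set.mem_singleton_iff, Prod.mk.injEq]
    tauto
  rw [condProb, measureReal_def, cond_apply (measurableSet_instrument z), hcell,
    ENNReal.toReal_mul, ENNReal.toReal_inv, measureReal_def, measureReal_def, div_eq_inv_mul]

namespace IsObservedLaw

theorem instrument_real_pos (hP : IsObservedLaw γ P) (z : Fin ℓ) :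
    0 < P.real {o | o.2.2 = z} := by
  have := hP.isProbabilityMeasure
  exact ENNReal.toReal_pos (hP.instrument_pos z).ne' (measure_ne_top _ _)

theorem real_singleton (hP : IsObservedLaw γ P) (k : Fin n) (d : Fin 2) (z : Fin ℓ) :
    P.real {(γ k, d, z)} = condProb γ P k d z * P.real {o | o.2.2 = z} := by
  rw [condProb_eq_div, div_mul_cancel₀ _ (hP.instrument_real_pos z).ne']

theorem ae_mem_range_prodMap (hP : IsObservedLaw γ P) :
    ∀ᵐ o ∂P, o ∈ Set.range (Prod.map γ (id : Fin 2 × Fin ℓ → Fin 2 × Fin ℓ)) := by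
  simpa [Set.range_prodMap] using hP.support

theorem isCondTable_condProb (hP : IsObservedLaw γ P) (hγ : Function.Injective γ) :
    IsCondTable (condProb γ P) := by
  have := hP.isProbabilityMeasure
  refine ⟨fun _ _ _ => measureReal_nonneg, fun z => ?_⟩
  have htotal := measureReal_eq_sum_of_ae_mem_range (hγ.prodMap Function.injective_id)
    hP.ae_mem_range_prodMap {o | o.2.2 = z}
  simp only [condProb_eq_div, ← Finset.sum_div]
  rw [div_eq_one_iff_eq (hP.instrument_real_pos z).ne', htotal]
  simp [Finset.sum_filter, Fintype.sum_prod_type]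

theorem ext (hγ : Function.Injective γ) (hP : IsObservedLaw γ P) (hQ : IsObservedLaw γ Q)
    (hinstr : ∀ z, P.real {o | o.2.2 = z} = Q.real {o | o.2.2 = z})
    (hcond : ∀ k d z, condProb γ P k d z = condProb γ Q k d z) : P = Q := by
  have := hP.isProbabilityMeasure
  have := hQ.isProbabilityMeasure
  refine measure_ext_of_ae_mem_range (hγ.prodMap Function.injective_id) hP.ae_mem_range_prodMap
    hQ.ae_mem_range_prodMap ?_
  rintro ⟨k, d, z⟩
  exact (hP.real_singleton k d z).trans <|
    (congrArg₂ _ (hcond k d z) (hinstr z)).trans (hQ.real_singleton k d z).symm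

end IsObservedLaw

theorem exists_isObservedLaw_condProb_eq [NeZero ℓ] (hγ : Function.Injective γ)
    {p : Fin n → Fin 2 → Fin ℓ → ℝ} (hp : IsCondTable p) :
    ∃ P : Measure (ℝ × Fin 2 × Fin ℓ), IsObservedLaw γ P ∧ condProb γ P = p := by
  have hℓ : (0 : ℝ) < ℓ := Nat.cast_pos.2 (NeZero.pos ℓ)
  have hsum : ∑ x : Fin n × Fin 2 × Fin ℓ, p x.1 x.2.1 x.2.2 / ℓ = 1 := by
    simp only [← Finset.sum_div, Fintype.sum_prod_type]
    simp only [Finset.sum_comm (s := (Finset.univ : Finset (Fin 2)))]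
    rw [Finset.sum_comm]
    simp only [hp.sum_eq_one]
    simp [hℓ.ne']
  have hf : Function.Injective (Prod.map γ (id : Fin 2 × Fin ℓ → Fin 2 × Fin ℓ)) :=
    hγ.prodMap Function.injective_id
  obtain ⟨P, hP, hrange, hcell⟩ := exists_isProbabilityMeasure_real_singleton hf
    (fun x => div_nonneg (hp.nonneg x.1 x.2.1 x.2.2) hℓ.le) hsum
  have hinstr (z : Fin ℓ) : P.real {o | o.2.2 = z} = 1 / ℓ := by
    rw [measureReal_eq_sum_of_ae_mem_range hf hrange, ← hp.sum_eq_one z, Finset.sum_div]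
    simp [hcell, Finset.sum_filter, Fintype.sum_prod_type, add_div]
  refine ⟨P, ⟨hP, ?_, fun z => ?_⟩, ?_⟩
  · filter_upwards [hrange] with _ ⟨x, hx⟩
    exact ⟨x.1, congrArg Prod.fst hx⟩
  · refine (ENNReal.toReal_pos_iff.1 ?_).1
    rw [← measureReal_def, hinstr]
    positivity
  · funext k d z
    rw [condProb_eq_div, hinstr]
    refine (congrArg (· / _) (hcell (k, d, z))).trans ?_
    field_simp

end ObservedLaws

namespace IsIVModel

variable {n ℓ : ℕ} {γ : Fin n → ℝ} {Ω : Type u} [MeasurableSpace Ω] {μ : Measure Ω}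
  {Ypot : Fin 2 → Fin ℓ → Ω → ℝ} {Dpot : Fin ℓ → Ω → Fin 2}
  {Y : Ω → ℝ} {D : Ω → Fin 2} {Z : Ω → Fin ℓ}

theorem measurable_observed (h : IsIVModel γ μ Ypot Dpot Y D Z) :
    Measurable fun ω => (Y ω, D ω, Z ω) :=
  h.measurable_Y.prodMk (h.measurable_D.prodMk h.measurable_Z)

theorem ae_treatment_eq (h : IsIVModel γ μ Ypot Dpot Y D Z) :
    ∀ᵐ ω ∂μ, D ω = Dpot (Z ω) ω := by
  filter_upwards [h.consistency_D] with ω hD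
  rw [Finset.sum_ite_eq, if_pos (Finset.mem_univ _)] at hD
  exact Fin.ext (Nat.cast_injective hD)

theorem ae_outcome_eq (h : IsIVModel γ μ Ypot Dpot Y D Z) (z₀ : Fin ℓ) :
    ∀ᵐ ω ∂μ, Y ω = Ypot (D ω) z₀ ω := by
  filter_upwards [h.consistency_Y z₀] with ω hY
  obtain hD | hD : D ω = 0 ∨ D ω = 1 := by omega
  · simpa [hD] using hY
  · simpa [hD] using hY

theorem ae_outcome_mem_range (h : IsIVModel γ μ Ypot Dpot Y D Z) :
    ∀ᵐ ω ∂μ, Y ω ∈ Set.range γ := by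
  have houtcome := ae_all_iff.2 h.ae_outcome_eq
  have hsupport := ae_all_iff.2 fun d => ae_all_iff.2 (h.support d)
  filter_upwards [houtcome, hsupport] with ω hY hmem
  exact hY (Z ω) ▸ hmem _ _

theorem isObservedLaw_map (h : IsIVModel γ μ Ypot Dpot Y D Z) (hZ : ∀ z, μ {ω | Z ω = z} ≠ 0) :
    IsObservedLaw γ (μ.map fun ω => (Y ω, D ω, Z ω)) where
  isProbabilityMeasure :=
    have := h.isProbabilityMeasure
    Measure.isProbabilityMeasure_map h.measurable_observed.aemeasurable
  support := (ae_map_iff h.measurable_observed.aemeasurable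
    ((Set.finite_range γ).measurableSet.preimage measurable_fst)).2 h.ae_outcome_mem_range
  instrument_pos z := by
    rw [Measure.map_apply h.measurable_observed (measurableSet_instrument z)]
    exact pos_iff_ne_zero.2 (hZ z)

theorem measureReal_observed_eq_mul (h : IsIVModel γ μ Ypot Dpot Y D Z) (z₀ : Fin ℓ) (t : ℝ)
    (d : Fin 2) (z : Fin ℓ) : μ.real {ω | (Y ω, D ω, Z ω) = (t, d, z)} =
      μ.real {ω | Z ω = z} * μ.real {ω | Ypot d z₀ ω = t ∧ Dpot z ω = d} := by
  let s : Set (ℝ × ℝ × (Fin ℓ → Fin 2)) := {x | ![x.1, x.2.1] d = t ∧ x.2.2 z = d}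
  have hs : MeasurableSet s := by
    refine MeasurableSet.inter (measurableSet_eq_fun ?_ measurable_const)
      (measurableSet_eq_fun (by fun_prop) measurable_const)
    fin_cases d
    · exact measurable_fst
    · exact measurable_snd.fst
  have hpre : (fun ω => (Ypot 0 z₀ ω, Ypot 1 z₀ ω, fun z => Dpot z ω)) ⁻¹' s =
      {ω | Ypot d z₀ ω = t ∧ Dpot z ω = d} := by
    fin_cases d <;> rfl
  have hindep := (h.randomAssignment z₀).measure_inter_preimage_eq_mul {z} s
    (measurableSet_singleton z) hs
  rw [hpre] at hindep
  have hobserved : {ω | (Y ω, D ω, Z ω) = (t, d, z)} =ᵐ[μ]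
      (Z ⁻¹' {z} ∩ {ω | Ypot d z₀ ω = t ∧ Dpot z ω = d} : Set Ω) := by
    refine Filter.eventuallyEq_set.2 ?_
    filter_upwards [h.ae_treatment_eq, h.ae_outcome_eq z₀] with ω hD hY
    simp only [Prod.mk.injEq, Set.mem_inter_iff, Set.mem_preimage, Set.mem_singleton_iff,
      Set.mem_ofPred_eq, hY, hD]
    grind
  rw [measureReal_congr hobserved, measureReal_def, hindep, ENNReal.toReal_mul]
  rfl

theorem condProb_map (h : IsIVModel γ μ Ypot Dpot Y D Z) {z : Fin ℓ} (hz : μ {ω | Z ω = z} ≠ 0)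
    (z₀ : Fin ℓ) (k : Fin n) (d : Fin 2) : condProb γ (μ.map fun ω => (Y ω, D ω, Z ω)) k d z =
      μ.real {ω | Ypot d z₀ ω = γ k ∧ Dpot z ω = d} := by
  have := h.isProbabilityMeasure
  rw [condProb_eq_div, map_measureReal_apply h.measurable_observed (measurableSet_instrument z),
    map_measureReal_apply h.measurable_observed (measurableSet_singleton _)]
  refine (congrArg (· / _) (h.measureReal_observed_eq_mul z₀ _ d z)).trans ?_
  exact mul_div_cancel_left₀ _ ((measureReal_ne_zero_iff).2 hz)

theorem sum_condProb_map_le_one (h : IsIVModel γ μ Ypot Dpot Y D Z) (hγ : Function.Injective γ)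
    (hZ : ∀ z, μ {ω | Z ω = z} ≠ 0) (d : Fin 2) (z : Fin n → Fin ℓ) :
    ∑ k, condProb γ (μ.map fun ω => (Y ω, D ω, Z ω)) k d (z k) ≤ 1 := by
  have := h.isProbabilityMeasure
  obtain _ | ⟨⟨k₀⟩⟩ := isEmpty_or_nonempty (Fin n)
  · simp
  simp only [h.condProb_map (hZ _) (z k₀)]
  rw [← measureReal_biUnion_finset]
  · exact measureReal_le_one
  · intro i _ j _ hij
    refine Set.disjoint_left.2 fun ω hi hj => hij (hγ ?_)
    exact hi.1.symm.trans hj.1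
  · intro k _
    exact (h.measurable_Ypot d _ (measurableSet_singleton (γ k))).inter
      (h.measurable_Dpot _ (measurableSet_singleton d))

end IsIVModel

section ProductModel

variable {n ℓ : ℕ} {γ : Fin n → ℝ} {A : Type u} [MeasurableSpace A] {ν : Measure A}
  [IsProbabilityMeasure ν] {Yp : Fin 2 → A → ℝ} {Dp : Fin ℓ → A → Fin 2}

theorem isIVModel_prod (ζ : Measure (Fin ℓ)) [IsProbabilityMeasure ζ]
    (hYp : ∀ d, Measurable (Yp d)) (hDp : ∀ z, Measurable (Dp z))
    (hrange : ∀ d, ∀ᵐ a ∂ν, Yp d a ∈ Set.range γ) :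
    IsIVModel γ (ν.prod ζ) (fun d _ ω => Yp d ω.1) (fun z ω => Dp z ω.1)
      (fun ω => Yp (Dp ω.2 ω.1) ω.1) (fun ω => Dp ω.2 ω.1) Prod.snd where
  isProbabilityMeasure := inferInstance
  measurable_Ypot d _ := (hYp d).comp measurable_fst
  measurable_Dpot z := (hDp z).comp measurable_fst
  measurable_Y :=
    have hYp' : Measurable fun x : A × Fin 2 => Yp x.2 x.1 :=
      measurable_from_prod_countable_left hYp
    measurable_from_prod_countable_left fun z => hYp'.comp (measurable_id.prodMk (hDp z))
  measurable_D := measurable_from_prod_countable_left hDp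
  measurable_Z := measurable_snd
  support d _ := measurePreserving_fst.quasiMeasurePreserving.ae (hrange d)
  exclusion _ _ _ := Filter.EventuallyEq.rfl
  randomAssignment _ :=
    (indepFun_prod (X := fun a => (Yp 0 a, Yp 1 a, fun z => Dp z a)) (Y := id)
      ((hYp 0).prodMk ((hYp 1).prodMk (measurable_pi_lambda _ hDp))) measurable_id).symm
  consistency_Y _ := Filter.Eventually.of_forall fun ω => by
    obtain hD | hD : Dp ω.2 ω.1 = 0 ∨ Dp ω.2 ω.1 = 1 := by omega
    · simp [hD]
    · simp [hD]
  consistency_D := Filter.Eventually.of_forall fun ω => by simp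

theorem IVCompatible.of_potential_outcomes {P : Measure (ℝ × Fin 2 × Fin ℓ)}
    (hγ : Function.Injective γ) (hP : IsObservedLaw γ P)
    (hYp : ∀ d, Measurable (Yp d)) (hDp : ∀ z, Measurable (Dp z))
    (hrange : ∀ d, ∀ᵐ a ∂ν, Yp d a ∈ Set.range γ)
    (hcond : ∀ k d z, ν.real {a | Yp d a = γ k ∧ Dp z a = d} = condProb γ P k d z) :
    IVCompatible.{u} γ P := by
  have := hP.isProbabilityMeasure
  have hsnd : Measurable fun o : ℝ × Fin 2 × Fin ℓ => o.2.2 := measurable_snd.snd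
  let ζ : Measure (Fin ℓ) := P.map fun o => o.2.2
  have : IsProbabilityMeasure ζ := Measure.isProbabilityMeasure_map hsnd.aemeasurable
  have hmodel := isIVModel_prod ζ hYp hDp hrange
  have hinstr (z : Fin ℓ) : (ν.prod ζ) {ω | ω.2 = z} = P {o | o.2.2 = z} :=
    (measurePreserving_snd.measure_preimage (measurableSet_singleton z).nullMeasurableSet).trans
      (Measure.map_apply hsnd (measurableSet_singleton z))
  have hZ (z : Fin ℓ) : (ν.prod ζ) {ω | ω.2 = z} ≠ 0 := hinstr z ▸ (hP.instrument_pos z).ne'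
  refine ⟨_, _, _, _, _, _, _, _, hmodel,
    IsObservedLaw.ext hγ (hmodel.isObservedLaw_map hZ) hP (fun z => ?_) fun k d z => ?_⟩
  · rw [map_measureReal_apply hmodel.measurable_observed (measurableSet_instrument z)]
    exact congrArg ENNReal.toReal (hinstr z)
  · rw [hmodel.condProb_map (hZ z) z, ← hcond]
    exact measurePreserving_fst.measureReal_preimage
      ((hYp d (measurableSet_singleton _)).inter
        (hDp z (measurableSet_singleton _))).nullMeasurableSet

end ProductModel

section Compatibility

variable {n ℓ : ℕ} {γ : Fin n → ℝ}

theorem IVCompatible.of_responseType_weights [NeZero ℓ] {P : Measure (ℝ × Fin 2 × Fin ℓ)}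
    (hγ : Function.Injective γ) (hP : IsObservedLaw γ P)
    {w : (Fin 2 → Fin n) × (Fin ℓ → Fin 2) → ℝ} (hw : ∀ x, 0 ≤ w x)
    (hw_cond : ∀ k d z, ∑ x with observedResponse x z = (k, d), w x = condProb γ P k d z) :
    IVCompatible.{u} γ P := by
  have hw_sum : ∑ x, w x = 1 := by
    rw [← Finset.sum_fiberwise _ (observedResponse · 0), Fintype.sum_prod_type]
    simp only [hw_cond]
    exact (hP.isCondTable_condProb hγ).sum_eq_one 0
  obtain ⟨ν, hν, hν_range, hν_singleton⟩ := exists_isProbabilityMeasure_real_singleton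
    ULift.up_injective hw hw_sum
  refine IVCompatible.of_potential_outcomes (ν := ν) (Yp := fun d a => γ (a.down.1 d))
    (Dp := fun z a => a.down.2 z) hγ hP (fun d => ?_) (fun z => ?_) (fun d => ?_) fun k d z => ?_
  · exact (measurable_of_finite fun x : (Fin 2 → Fin n) × (Fin ℓ → Fin 2) => γ (x.1 d)).comp
      measurable_down
  · exact (measurable_of_finite fun x : (Fin 2 → Fin n) × (Fin ℓ → Fin 2) => x.2 z).comp
      measurable_down
  · exact Filter.Eventually.of_forall fun _ => Set.mem_range_self _
  · classical
    rw [← hw_cond, measureReal_eq_sum_of_ae_mem_range ULift.up_injective hν_range]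
    simp only [hν_singleton]
    refine Finset.sum_congr (Finset.filter_congr fun x _ => ?_) fun _ _ => rfl
    simp only [observedResponse, Prod.mk.injEq, Set.mem_ofPred_eq, hγ.eq_iff]
    grind

theorem ivCompatible_iff_forall_sum_le_one {P : Measure (ℝ × Fin 2 × Fin 2)}
    (hγ : Function.Injective γ) (hP : IsObservedLaw γ P) :
    IVCompatible.{u} γ P ↔ ∀ d (z : Fin n → Fin 2), ∑ k, condProb γ P k d (z k) ≤ 1 := by
  constructor
  · rintro ⟨Ω, _, μ, Ypot, Dpot, Y, D, Z, h, rfl⟩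
    refine h.sum_condProb_map_le_one hγ fun z hz => (hP.instrument_pos z).ne' ?_
    rwa [Measure.map_apply h.measurable_observed (measurableSet_instrument z)]
  · intro h
    obtain ⟨w, hw, hw_cond⟩ := (hP.isCondTable_condProb hγ).exists_responseType_weights h
    exact .of_responseType_weights hγ hP hw hw_cond

theorem ivCompatible_iff_forall_mem_ivForms {m : ℕ} {γ : Fin (m + 1) → ℝ}
    {P : Measure (ℝ × Fin 2 × Fin 2)} (hγ : Function.Injective γ)
    (hP : IsObservedLaw γ P) :
    IVCompatible.{u} γ P ↔ ∀ L ∈ ivForms (m + 1), L (condProb γ P) ≤ 0 :=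
  (ivCompatible_iff_forall_sum_le_one hγ hP).trans
    (forall_mem_ivForms_iff (hP.isCondTable_condProb hγ)).symm

end Compatibility

section Irredundancy

variable {m : ℕ}

theorem exists_isCondTable_pearlForm_pos (d : Fin 2) {z : Fin (m + 1) → Fin 2}
    (hz : ∃ i j, z i ≠ z j) :
    ∃ p : Fin (m + 1) → Fin 2 → Fin 2 → ℝ, IsCondTable p ∧ 0 < pearlForm d z p ∧
      ∀ d' z', (d', z') ≠ (d, z) → pearlForm d' z' p ≤ 0 := by
  have hp := isCondTable_extremalTable d hz
  refine ⟨extremalTable d z, hp, ?_, fun d' z' hne => ?_⟩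
  · rw [hp.pearlForm_apply, sub_pos]
    exact one_lt_sum_extremalTable d hz
  · rw [hp.pearlForm_apply, sub_nonpos]
    exact sum_extremalTable_le_one d hz hne

theorem injOn_pearlForm : Set.InjOn
    (fun x : Fin 2 × (Fin (m + 1) → Fin 2) => pearlForm x.1 x.2) {x | ∃ i j, x.2 i ≠ x.2 j} := by
  rintro ⟨d, z⟩ hz ⟨d', z'⟩ - heq
  by_contra hne
  obtain ⟨p, -, hpos, hnonpos⟩ := exists_isCondTable_pearlForm_pos d hz
  exact (hnonpos d' z' (Ne.symm hne)).not_gt (hpos.trans_eq (congrFun heq p))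

theorem ncard_ivForms : (ivForms (m + 1)).ncard = 2 ^ (m + 2) - 4 := by
  have hnonconst : {x : Fin 2 × (Fin (m + 1) → Fin 2) | ∃ i j, x.2 i ≠ x.2 j} =
      Set.univ ×ˢ (Set.range (Function.const (Fin (m + 1))))ᶜ := by
    ext ⟨d, z⟩
    simp only [Set.mem_ofPred_eq, Set.mem_prod, Set.mem_univ, true_and, Set.mem_compl_iff,
      Set.mem_range]
    refine ⟨?_, fun h => ?_⟩
    · rintro ⟨i, j, hij⟩ ⟨b, rfl⟩
      exact hij rfl
    · by_contra! hz
      exact h ⟨z 0, funext fun k => hz 0 k⟩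
  rw [ivForms_eq_image_pearlForm, injOn_pearlForm.ncard_image, hnonconst, Set.ncard_prod,
    Set.ncard_compl, Set.ncard_range_of_injective Function.const_injective, Set.ncard_univ]
  simp only [Nat.card_eq_fintype_card, Fintype.card_fun, Fintype.card_fin]
  rw [Nat.mul_sub, ← pow_succ']

end Irredundancy

theorem mainTheorem5_general (n : ℕ) (hn : 1 ≤ n) (γ : Fin n → ℝ) (hγ : Function.Injective γ) :
    (∀ P : Measure (ℝ × Fin 2 × Fin 2), IsObservedLaw γ P →
      (IVCompatible.{u} γ P ↔ ∀ L ∈ ivForms n, L (condProb γ P) ≤ 0)) ∧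
    (∀ L ∈ ivForms n, ∃ P : Measure (ℝ × Fin 2 × Fin 2), IsObservedLaw γ P ∧
      0 < L (condProb γ P) ∧ ∀ L' ∈ ivForms n, L' ≠ L → L' (condProb γ P) ≤ 0) ∧
    (ivForms n).ncard = 2 ^ (n + 1) - 4 := by
  obtain ⟨m, rfl⟩ := Nat.exists_eq_add_of_le' hn
  refine ⟨fun P hP => ivCompatible_iff_forall_mem_ivForms hγ hP, fun L hL => ?_, ncard_ivForms⟩
  rw [ivForms_eq_image_pearlForm] at hL ⊢
  obtain ⟨⟨d, z⟩, hz, rfl⟩ := hL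
  obtain ⟨p, hp, hpos, hnonpos⟩ := exists_isCondTable_pearlForm_pos d hz
  obtain ⟨P, hP, rfl⟩ := exists_isObservedLaw_condProb_eq hγ hp
  refine ⟨P, hP, hpos, ?_⟩
  rintro _ ⟨⟨d', z'⟩, -, rfl⟩ hne
  exact hnonpos d' z' fun h => hne (by rw [h])

theorem mainTheorem5 (n : ℕ) (hn : 1 ≤ n) (γ : Fin n → ℝ) (hγ : StrictMono γ) :
    (∀ P : Measure (ℝ × Fin 2 × Fin 2), IsObservedLaw γ P →
      (IVCompatible.{u} γ P ↔ ∀ L ∈ ivForms n, L (condProb γ P) ≤ 0)) ∧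
    (∀ L ∈ ivForms n, ∃ P : Measure (ℝ × Fin 2 × Fin 2), IsObservedLaw γ P ∧
      0 < L (condProb γ P) ∧ ∀ L' ∈ ivForms n, L' ≠ L → L' (condProb γ P) ≤ 0) ∧
    (ivForms n).ncard = 2 ^ (n + 1) - 4 :=
  mainTheorem5_general n hn γ hγ.injective
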